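/- Let $K$ be a number field with ring of integers $\mathfrak o$, class number $h_K=1$ and at most one real place. Let $\mathbb A_f$ be the ring of finite adeles of $K$, let $K_\infty=\prod_{\nu\mid\infty}K_\nu$ be the product of the completions at the infinite places, and let $\mathbb A^*$ be the idele group, i.e. the unit group of $\mathbb A=K_\infty\times\mathbb A_f$ with its usual restricted product topology. Put $\hat{\mathfrak o}^*=\prod_{\nu\nmid\infty}\mathfrak o_\nu^*$, regarded as a subgroup of $\mathbb A^*$ by inserting $1$ at the infinite places. Let $K_{\infty,+}^\times$ be the connected component of the identity in $K_\infty^\times$ (embedded in $\mathbb A^*$ with $1$ at the finite places), embed $K^\times$ diagonally in $\mathbb A^*$, and let $U=\overline{K^\times K_{\infty,+}^\times}$ be the closure in $\mathbb A^*$. Let $\mathbb A_f/\!\sim_{\hat{\mathfrak o}^*\cap U}$ be the quotient space of $\mathbb A_f$ by the relation: $y\sim\tilde y$ if and only if $y=z\tilde y$ for some $z\in\hat{\mathfrak o}^*\cap U$. Let $\mathbb A^*/U\times_{\hat{\mathfrak o}^*}\mathbb A_f$ be the quotient space of $\mathbb A^*/U\times\mathbb A_f$ by the relation: $(x,y)\sim(x',y')$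 if and only if $(rx,r^{-1}y)=(x',y')$ for some $r\in\hat{\mathfrak o}^*$. Both carry the quotient topology, and $(\cdot)^\bullet$ denotes classes. Then the well-defined map $$\varphi^*:\ \mathbb A_f/\!\sim_{\hat{\mathfrak o}^*\cap U}\ \longrightarrow\ \mathbb A^*/U\times_{\hat{\mathfrak o}^*}\mathbb A_f,\qquad y^\bullet\longmapsto\big((1)^\bullet,y\big)^\bullet,$$ is a homeomorphism. -/

import Mathlib

open NumberField IsDedekindDomain
open scoped NumberField.AdeleRing

namespace AdelicQuotient

noncomputable section

variable (K : Type*) [Field K] [NumberField K]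

/-- The idele group `𝔸*`: the units of the adele ring `𝔸 = K∞ × 𝔸_f`, with the unit-group topology
(which is the restricted product topology). -/
abbrev Ideles : Type _ := (𝔸[K])ˣ

/-- The embedding `K∞ˣ → 𝔸*`, with `1` at all finite places. -/
def infToIdeles : (K∞)ˣ →* Ideles K :=
  Units.map
    { toFun := fun x => ((x, 1) : K∞ × 𝔸ᶠ[K])
      map_one' := rfl
      map_mul' := fun _ _ => Prod.ext rfl (one_mul (1 : 𝔸ᶠ[K])).symm : K∞ →* 𝔸[K] }

/-- The embedding `𝔸_fˣ → 𝔸*`, with `1` at all infinite places. -/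
def finToIdeles : (𝔸ᶠ[K])ˣ →* Ideles K :=
  Units.map
    { toFun := fun y => ((1, y) : K∞ × 𝔸ᶠ[K])
      map_one' := rfl
      map_mul' := fun _ _ => Prod.ext (one_mul (1 : K∞)).symm rfl : 𝔸ᶠ[K] →* 𝔸[K] }

/-- The principal ideles: `Kˣ` embedded diagonally in `𝔸*`. -/
def principalIdeles : Subgroup (Ideles K) :=
  (Units.map (algebraMap K 𝔸[K] : K →* 𝔸[K])).range

/-- `K_{∞,+}ˣ`: the connected component of the identity of `K∞ˣ`, as a subgroup of `𝔸*`. -/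
def infPos : Subgroup (Ideles K) :=
  (Subgroup.connectedComponentOfOne (K∞)ˣ).map (infToIdeles K)

/-- `U`: the closure in `𝔸*` of the product of the subgroups `Kˣ` and `K_{∞,+}ˣ`. -/
def U : Subgroup (Ideles K) :=
  (principalIdeles K ⊔ infPos K).topologicalClosure

instance : (U K).Normal := inferInstance

/-- `ô* = ∏_v o_v*` (over the finite places `v`) as a group of finite ideles: `o_v*` consists of
the elements of `K_v` of valuation one. -/
def integralUnits : Subgroup (𝔸ᶠ[K])ˣ where
  carrier := {u | ∀ v : HeightOneSpectrum (𝓞 K), Valued.v ((u : 𝔸ᶠ[K]) v) = 1}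
  one_mem' := fun v => map_one (Valued.v (R := v.adicCompletion K))
  mul_mem' := by
    intro a b ha hb v
    have h : ((a * b : (𝔸ᶠ[K])ˣ) : 𝔸ᶠ[K]) v = (a : 𝔸ᶠ[K]) v * (b : 𝔸ᶠ[K]) v := rfl
    rw [h, map_mul, ha v, hb v, one_mul]
  inv_mem' := by
    intro a ha v
    have h : (a : 𝔸ᶠ[K]) v * ((a⁻¹ : (𝔸ᶠ[K])ˣ) : 𝔸ᶠ[K]) v = 1 :=
      congrArg (fun x : 𝔸ᶠ[K] => x v) a.mul_inv
    have h' := congrArg Valued.v h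
    rwa [map_mul, ha v, one_mul, map_one] at h'

/-- `ô* ∩ U`, as a group of finite ideles. -/
def integralUnitsInU : Subgroup (𝔸ᶠ[K])ˣ :=
  integralUnits K ⊓ (U K).comap (finToIdeles K)

/-- The relation `y ∼ y'` on `𝔸_f`: there is `z ∈ ô* ∩ U` with `y = z y'`. -/
def finSetoid : Setoid 𝔸ᶠ[K] where
  r y y' := ∃ z ∈ integralUnitsInU K, y = (z : 𝔸ᶠ[K]) * y'
  iseqv :=
    { refl := fun y => ⟨1, one_mem _, by simp⟩
      symm := by
        rintro y y' ⟨z, hz, rfl⟩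
        exact ⟨z⁻¹, inv_mem hz, by simp⟩
      trans := by
        rintro y y' y'' ⟨z, hz, rfl⟩ ⟨w, hw, rfl⟩
        exact ⟨z * w, mul_mem hz hw, by simp [mul_assoc]⟩ }

/-- The relation on `𝔸*/U × 𝔸_f`: `(x, y) ∼ (x', y')` if there is `r ∈ ô*` with
`(r x, r⁻¹ y) = (x', y')`. -/
def balancedSetoid : Setoid ((Ideles K ⧸ U K) × 𝔸ᶠ[K]) where
  r p q := ∃ r ∈ integralUnits K,
    ((finToIdeles K r : Ideles K ⧸ U K) * p.1, ((r⁻¹ : (𝔸ᶠ[K])ˣ) : 𝔸ᶠ[K]) * p.2) = q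
  iseqv :=
    { refl := fun p => ⟨1, one_mem _, by simp⟩
      symm := by
        rintro p q ⟨r, hr, rfl⟩
        exact ⟨r⁻¹, inv_mem hr, by simp⟩
      trans := by
        rintro p q s ⟨r, hr, rfl⟩ ⟨t, ht, rfl⟩
        exact ⟨t * r, mul_mem ht hr, by simp [mul_assoc, mul_left_comm]⟩ }

/-- The quotient space `𝔸_f / ∼_{ô* ∩ U}`, with the quotient topology. -/
abbrev FinQuotient : Type _ := Quotient (finSetoid K)

/-- The space `𝔸*/U ×_{ô*} 𝔸_f`, with the quotient topology of the product topology. -/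
abbrev BalancedProduct : Type _ := Quotient (balancedSetoid K)

/-- The map `φ*` sending the class of `y` to the class of `(1, y)`. -/
def phiStar : FinQuotient K → BalancedProduct K :=
  Quotient.map (sa := finSetoid K) (sb := balancedSetoid K) (fun y => (1, y)) (by
    rintro y y' ⟨z, hz, rfl⟩
    refine ⟨z, hz.1, Prod.ext ?_ (by simp)⟩
    have h : (finToIdeles K z : Ideles K ⧸ U K) = 1 := (QuotientGroup.eq_one_iff _).2 hz.2
    simp [h])

end

end AdelicQuotient

/-!
Write `Q = 𝔸* / U`. If the homomorphism `π : ô* → Q` is an open quotient map, then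
`(r, y) ↦ (π r, y)^•` is a quotient map from `ô* × 𝔸_f` onto the balanced product, and it factors
through `φ*` as `(r, y) ↦ (r y)^• ↦ (1, r y)^• = (π r, y)^•`. Hence `φ*`, which is continuous and
injective, is a quotient map, that is, a homeomorphism.

The map `π` is open because `K_{∞,+}ˣ × ô*` is open in `𝔸*` and its first factor dies in `Q`.
It is surjective because class number one gives `𝔸_fˣ = Kˣ ô*`, while `K∞ˣ = 𝔬* K_{∞,+}ˣ` as soon
as the units of `𝔬` realise all sign patterns at the real places; with at most one real place,
`±1` do.
-/

open Topology

namespace AdelicQuotient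

section BalancedProduct

variable {H Q Y : Type*} [Group H] [Group Q] [MulAction H Y] [TopologicalSpace H]
  [TopologicalSpace Q] [TopologicalSpace Y] [ContinuousSMul H Y]

theorem isHomeomorph_quotientMap_one_prodMk {π : H →* Q} (hπ : IsOpenQuotientMap π)
    {s : Setoid Y} {t : Setoid (Q × Y)} (hs : ∀ y y', s y y' ↔ ∃ h ∈ π.ker, y = h • y')
    (ht : ∀ p q, t p q ↔ ∃ h, (π h * p.1, h⁻¹ • p.2) = q)
    (hst : ∀ y y', s y y' → t (1, y) (1, y')) :
    IsHomeomorph (Quotient.map (fun y ↦ ((1 : Q), y)) hst) := by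
  set φ := Quotient.map (fun y ↦ ((1 : Q), y)) hst
  have hφ : Continuous φ := (Continuous.prodMk_right 1).quotient_map' hst
  have hinj : φ.Injective := by
    rintro ⟨y⟩ ⟨y'⟩ h
    obtain ⟨r, hr⟩ := (ht _ _).1 (Quotient.exact h)
    obtain ⟨hr₁, hr₂⟩ := Prod.ext_iff.1 hr
    exact Quotient.sound ((hs _ _).2 ⟨r, by simpa using hr₁, inv_smul_eq_iff.1 hr₂⟩)
  have hfactor : φ ∘ (fun p : H × Y ↦ Quotient.mk s (p.1 • p.2)) =
      Quotient.mk t ∘ Prod.map π id := by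
    ext ⟨r, y⟩
    exact Quotient.sound ((ht _ _).2 ⟨r, by simp⟩)
  have hquot : IsQuotientMap (Quotient.mk t ∘ Prod.map π (id : Y → Y)) :=
    isQuotientMap_quotient_mk'.comp (hπ.prodMap .id).isQuotientMap
  exact isHomeomorph_iff_isQuotientMap_injective.2
    ⟨.of_comp (continuous_quotient_mk'.comp continuous_smul) hφ (hfactor ▸ hquot), hinj⟩

end BalancedProduct

section PrincipalIdealRing

variable {R F : Type*} [CommRing R] [IsDedekindDomain R] [Field F] [Algebra R F]
  [IsFractionRing R F]

theorem exists_uniformizer_valuation_eq_one_of_ne [IsPrincipalIdealRing R]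
    (v : HeightOneSpectrum R) :
    ∃ p : Fˣ, v.valuation F p = WithZero.exp (-1) ∧ ∀ w ≠ v, w.valuation F (p : F) = 1 := by
  obtain ⟨p, hp : v.asIdeal = Ideal.span {p}⟩ := IsPrincipalIdealRing.principal v.asIdeal
  have hp0 : p ≠ 0 := by
    rintro rfl
    exact v.ne_bot (by simpa using hp)
  refine ⟨Units.mk0 (algebraMap R F p) (by simpa using hp0), ?_, fun w hw ↦ ?_⟩
  · rw [Units.val_mk0, v.valuation_of_algebraMap, v.intValuation_singleton hp0 hp]
  · rw [Units.val_mk0, HeightOneSpectrum.valuation_eq_one_iff_notMem]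
    intro hmem
    have hle : v.asIdeal ≤ w.asIdeal := hp ▸ (Ideal.span_singleton_le_iff_mem _).2 hmem
    exact hw (HeightOneSpectrum.ext (v.isMaximal.eq_of_le w.isPrime.ne_top hle).symm)

theorem exists_valuation_eq_exp [IsPrincipalIdealRing R] (n : HeightOneSpectrum R → ℤ)
    (hn : n.support.Finite) :
    ∃ k : Fˣ, ∀ v : HeightOneSpectrum R, v.valuation F (k : F) = WithZero.exp (n v) := by
  classical
  choose p hp hp' using fun v : HeightOneSpectrum R ↦
    exists_uniformizer_valuation_eq_one_of_ne (F := F) v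
  refine ⟨∏ w ∈ hn.toFinset, p w ^ (-n w), fun v ↦ ?_⟩
  rw [Units.coe_prod, map_prod, Finset.prod_eq_single v]
  · simp [hp, ← WithZero.exp_zsmul]
  · intro w _ hw
    simp [hp' w v hw.symm]
  · intro hv
    simp_all

open scoped FiniteAdeleRing

theorem finiteAdele_mul_apply (x y : 𝔸ᶠ[R, F]) (v : HeightOneSpectrum R) :
    (x * y) v = x v * y v := rfl

theorem valued_units_inv_apply (u : (𝔸ᶠ[R, F])ˣ) (v : HeightOneSpectrum R) :
    Valued.v ((↑u⁻¹ : 𝔸ᶠ[R, F]) v) = (Valued.v ((u : 𝔸ᶠ[R, F]) v))⁻¹ := by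
  refine eq_inv_of_mul_eq_one_right ?_
  rw [← map_mul, ← finiteAdele_mul_apply, Units.mul_inv]
  exact map_one (Valued.v (R := v.adicCompletion F))

theorem exists_valuation_eq_valued [IsPrincipalIdealRing R] (a : (𝔸ᶠ[R, F])ˣ) :
    ∃ k : Fˣ, ∀ v, v.valuation F (k : F) = Valued.v ((a : 𝔸ᶠ[R, F]) v) := by
  obtain ⟨ha0, ha⟩ := FiniteAdeleRing.isUnit_iff.1 a.isUnit
  have hfin : (fun v ↦ WithZero.log (Valued.v ((a : 𝔸ᶠ[R, F]) v))).support.Finite := by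
    refine Set.Finite.subset ha fun v hv ↦ ?_
    contrapose! hv
    simp_all
  obtain ⟨k, hk⟩ := exists_valuation_eq_exp (F := F) _ hfin
  exact ⟨k, fun v ↦ by rw [hk, WithZero.exp_log ((Valuation.ne_zero_iff _).2 (ha0 v))]⟩

end PrincipalIdealRing

section FinitePlaces

variable (K : Type*) [Field K] [NumberField K]

theorem range_unitEmbedding_sup_integralUnits [IsPrincipalIdealRing (𝓞 K)] :
    (FiniteAdeleRing.unitEmbedding (𝓞 K) K).range ⊔ integralUnits K = ⊤ := by
  refine eq_top_iff.2 fun a _ ↦ ?_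
  obtain ⟨k, hk⟩ := exists_valuation_eq_valued (F := K) a
  rw [← mul_inv_cancel_left (FiniteAdeleRing.unitEmbedding (𝓞 K) K k) a]
  refine Subgroup.mul_mem_sup ⟨k, rfl⟩ fun v ↦ ?_
  have ha0 := (FiniteAdeleRing.isUnit_iff.1 a.isUnit).1 v
  rw [Units.val_mul, finiteAdele_mul_apply, map_mul, valued_units_inv_apply,
    FiniteAdeleRing.unitEmbedding_apply, FiniteAdeleRing.algebraMap_apply,
    HeightOneSpectrum.valuedAdicCompletion_eq_valuation', hk]
  exact inv_mul_cancel₀ ((Valuation.ne_zero_iff _).2 ha0)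

theorem unitEmbedding_mem_integralUnits (ε : (𝓞 K)ˣ) :
    FiniteAdeleRing.unitEmbedding (𝓞 K) K (Units.map (algebraMap (𝓞 K) K) ε) ∈
      integralUnits K := fun v ↦ by
  rw [FiniteAdeleRing.unitEmbedding_apply, FiniteAdeleRing.algebraMap_apply,
    HeightOneSpectrum.valuedAdicCompletion_eq_valuation']
  exact v.valuation_eq_one_iff_notMem.2 fun h ↦
    v.isPrime.ne_top (Ideal.eq_top_of_isUnit_mem _ h ε.isUnit)

theorem isOpen_integralUnits : IsOpen (integralUnits K : Set (𝔸ᶠ[K])ˣ) := by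
  have hO : IsOpen {x : 𝔸ᶠ[K] | ∀ v, x v ∈ v.adicCompletionIntegers K} :=
    RestrictedProduct.isOpen_forall_mem fun v ↦ Valued.isOpen_valuationSubring _
  convert (hO.preimage Units.continuous_val).inter (hO.preimage Units.continuous_coe_inv)
  ext u
  refine ⟨fun hu ↦ ⟨fun v ↦ (hu v).le, fun v ↦ (inv_mem hu v).le⟩, fun ⟨hu, hu'⟩ v ↦ ?_⟩
  have hinv : (Valued.v ((u : 𝔸ᶠ[K]) v))⁻¹ ≤ 1 := valued_units_inv_apply u v ▸ hu' v
  have hne := (Valuation.ne_zero_iff Valued.v).2 ((FiniteAdeleRing.isUnit_iff.1 u.isUnit).1 v)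
  exact le_antisymm (hu v) ((inv_le_one₀ (zero_lt_iff.2 hne)).1 hinv)

end FinitePlaces

section InfinitePlaces

open InfinitePlace InfinitePlace.Completion

theorem isPreconnected_setOf_units_map_mem {F E : Type*} [GroupWithZero F] [TopologicalSpace F]
    [ContinuousInv₀ F] [TopologicalSpace E] (e : F ≃ₜ E) {s : Set E} (hs : IsPreconnected s)
    (h0 : e 0 ∉ s) : IsPreconnected {u : Fˣ | e u ∈ s} := by
  rw [← (Units.isEmbedding_val₀ (G₀ := F)).isInducing.isPreconnected_image]
  convert e.isPreconnected_preimage.2 hs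
  refine Set.Subset.antisymm (by rintro _ ⟨u, hu, rfl⟩; exact hu) fun x hx ↦ ?_
  exact ⟨Units.mk0 x fun h ↦ h0 (h ▸ hx), hx, rfl⟩

variable {K : Type*} [Field K]

theorem isPreconnected_setOf_units_forall_isReal_pos (v : InfinitePlace K) :
    IsPreconnected {u : (v.Completion)ˣ | ∀ hv : v.IsReal,
      0 < extensionEmbeddingOfIsReal hv (u : v.Completion)} := by
  rcases v.isReal_or_isComplex with hv | hv
  · simp only [hv, forall_true_left]
    exact isPreconnected_setOf_units_map_mem (isometryEquivRealOfIsReal hv).toHomeomorph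
      isPreconnected_Ioi (map_zero (ringEquivRealOfIsReal hv)).le.not_gt
  · have hC : IsPreconnected ({0}ᶜ : Set ℂ) :=
      (isConnected_compl_singleton_of_one_lt_rank (by simp [Complex.rank_real_complex])
        0).isPreconnected
    convert isPreconnected_setOf_units_map_mem (isometryEquivComplexOfIsComplex hv).toHomeomorph
      hC fun h ↦ h (map_zero (ringEquivComplexOfIsComplex hv)) with u
    exact iff_of_true (fun hv' ↦ absurd hv' (not_isReal_iff_isComplex.2 hv))
      ((map_ne_zero (ringEquivComplexOfIsComplex hv)).2 u.ne_zero)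

/-- The coordinate of an element of `K∞` at a real place, as a real number. -/
noncomputable def realCoordinate {v : InfinitePlace K} (hv : v.IsReal) : K∞ →+* ℝ :=
  (extensionEmbeddingOfIsReal hv).comp (Pi.evalRingHom _ v)

theorem continuous_realCoordinate {v : InfinitePlace K} (hv : v.IsReal) :
    Continuous (realCoordinate hv) :=
  (isometry_extensionEmbeddingOfIsReal hv).continuous.comp (continuous_apply v)

variable (K)

/-- The units of `K∞` that are positive at every real place. They form the component of the
identity; only the inclusion into that component is needed, so a bare set is enough. -/
def totallyPositiveUnits : Set (K∞)ˣ :=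
  {x | ∀ (v : InfinitePlace K) (hv : v.IsReal), 0 < realCoordinate hv x}

theorem one_mem_totallyPositiveUnits : 1 ∈ totallyPositiveUnits K := fun v hv ↦ by simp

theorem totallyPositiveUnits_subset_connectedComponentOfOne :
    totallyPositiveUnits K ⊆ Subgroup.connectedComponentOfOne (K∞)ˣ := by
  refine IsPreconnected.subset_connectedComponent ?_ (one_mem_totallyPositiveUnits K)
  have hpi := isPreconnected_univ_pi (isPreconnected_setOf_units_forall_isReal_pos (K := K))
  have hpre : totallyPositiveUnits K =
      ContinuousMulEquiv.piUnits (M := fun v : InfinitePlace K ↦ v.Completion) ⁻¹'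
        Set.univ.pi fun v ↦ {u | ∀ hv : v.IsReal,
          0 < extensionEmbeddingOfIsReal hv (u : v.Completion)} :=
    Set.ext fun x ↦ ⟨fun h v _ ↦ h v, fun h v ↦ h v trivial⟩
  rw [hpre]
  exact ContinuousMulEquiv.piUnits.toHomeomorph.isPreconnected_preimage.2 hpi

variable [NumberField K]

theorem isOpen_totallyPositiveUnits : IsOpen (totallyPositiveUnits K) := by
  simp only [totallyPositiveUnits, Set.ofPred_forall]
  exact isOpen_iInter_of_finite fun v ↦ isOpen_iInter_of_finite fun hv ↦
    isOpen_Ioi.preimage ((continuous_realCoordinate hv).comp Units.continuous_val)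

theorem isOpen_connectedComponentOfOne_infiniteAdele :
    IsOpen (Subgroup.connectedComponentOfOne (K∞)ˣ : Set (K∞)ˣ) :=
  Subgroup.isOpen_of_mem_nhds _ (g := 1) <| Filter.mem_of_superset
    ((isOpen_totallyPositiveUnits K).mem_nhds (one_mem_totallyPositiveUnits K))
    (totallyPositiveUnits_subset_connectedComponentOfOne K)

variable {K}

theorem mem_or_neg_mem_totallyPositiveUnits (h : nrRealPlaces K ≤ 1) (x : (K∞)ˣ) :
    x ∈ totallyPositiveUnits K ∨ -x ∈ totallyPositiveUnits K := by
  classical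
  by_contra! hx
  simp only [totallyPositiveUnits, Set.mem_ofPred_eq, not_forall, not_lt, Units.val_neg,
    map_neg, Left.neg_nonpos_iff] at hx
  obtain ⟨⟨v, hv, hle⟩, w, hw, hge⟩ := hx
  obtain rfl : v = w :=
    congrArg Subtype.val ((Fintype.card_le_one_iff_subsingleton.1 h).elim ⟨v, hv⟩ ⟨w, hw⟩)
  exact (x.isUnit.map (realCoordinate hv)).ne_zero (le_antisymm hle hge)

theorem range_units_sup_connectedComponentOfOne (h : nrRealPlaces K ≤ 1) :
    (Units.map (algebraMap (𝓞 K) K∞ : 𝓞 K →* K∞)).range ⊔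
      Subgroup.connectedComponentOfOne (K∞)ˣ = ⊤ := by
  have hsub := totallyPositiveUnits_subset_connectedComponentOfOne K
  refine eq_top_iff.2 fun x _ ↦ ?_
  rcases mem_or_neg_mem_totallyPositiveUnits h x with hx | hx
  · exact Subgroup.mem_sup_right (hsub hx)
  · rw [show x = -1 * -x by simp]
    exact Subgroup.mul_mem_sup ⟨-1, by ext1; simp⟩ (hsub hx)

end InfinitePlaces

section Ideles

variable (K : Type*) [Field K] [NumberField K]

theorem isHomeomorph_infToIdeles_mul_finToIdeles :
    IsHomeomorph fun p : (K∞)ˣ × (𝔸ᶠ[K])ˣ ↦ infToIdeles K p.1 * finToIdeles K p.2 := by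
  have heq : (fun p : (K∞)ˣ × (𝔸ᶠ[K])ˣ ↦ infToIdeles K p.1 * finToIdeles K p.2) =
      (Homeomorph.prodUnits (α := K∞) (β := 𝔸ᶠ[K])).symm :=
    funext fun p ↦ Units.ext (Prod.ext (mul_one (p.1 : K∞)) (one_mul (p.2 : 𝔸ᶠ[K])))
  rw [heq]
  exact (Homeomorph.prodUnits (α := K∞) (β := 𝔸ᶠ[K])).symm.isHomeomorph

theorem infToIdeles_mul_finToIdeles_of_principal (k : Kˣ) :
    infToIdeles K (Units.map (algebraMap K K∞ : K →* K∞) k) *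
      finToIdeles K (FiniteAdeleRing.unitEmbedding (𝓞 K) K k) =
    Units.map (algebraMap K 𝔸[K] : K →* 𝔸[K]) k :=
  Units.ext (Prod.ext (mul_one (algebraMap K K∞ k)) (one_mul (algebraMap K 𝔸ᶠ[K] k)))

theorem principalIdeles_le_U : principalIdeles K ≤ U K :=
  le_sup_left.trans (Subgroup.le_topologicalClosure _)

theorem infPos_le_U : infPos K ≤ U K :=
  le_sup_right.trans (Subgroup.le_topologicalClosure _)

variable {K}

theorem range_infToIdeles_le
    (hsign : (Units.map (algebraMap (𝓞 K) K∞ : 𝓞 K →* K∞)).range ⊔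
      Subgroup.connectedComponentOfOne (K∞)ˣ = ⊤) :
    (infToIdeles K).range ≤ (integralUnits K).map (finToIdeles K) ⊔ U K := by
  rw [MonoidHom.range_eq_map, ← hsign, Subgroup.map_sup]
  refine sup_le ?_ ((infPos_le_U K).trans le_sup_right)
  rintro _ ⟨_, ⟨ε, rfl⟩, rfl⟩
  set k : Kˣ := Units.map (algebraMap (𝓞 K) K) ε
  change infToIdeles K (Units.map (algebraMap K K∞ : K →* K∞) k) ∈ _
  rw [eq_mul_inv_of_mul_eq (infToIdeles_mul_finToIdeles_of_principal K k), mul_comm]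
  exact Subgroup.mul_mem_sup
    (inv_mem (Subgroup.mem_map_of_mem _ (unitEmbedding_mem_integralUnits K ε)))
    (principalIdeles_le_U K ⟨k, rfl⟩)

theorem map_integralUnits_sup_U (hclass : classNumber K = 1)
    (hsign : (Units.map (algebraMap (𝓞 K) K∞ : 𝓞 K →* K∞)).range ⊔
      Subgroup.connectedComponentOfOne (K∞)ˣ = ⊤) :
    (integralUnits K).map (finToIdeles K) ⊔ U K = ⊤ := by
  have := (classNumber_eq_one_iff (K := K)).1 hclass
  set S := (integralUnits K).map (finToIdeles K) ⊔ U K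
  have hinf : (infToIdeles K).range ≤ S := range_infToIdeles_le hsign
  have hfin : (finToIdeles K).range ≤ S := by
    rw [MonoidHom.range_eq_map, ← range_unitEmbedding_sup_integralUnits, Subgroup.map_sup]
    refine sup_le ?_ le_sup_left
    rintro _ ⟨_, ⟨k, rfl⟩, rfl⟩
    rw [eq_inv_mul_of_mul_eq (infToIdeles_mul_finToIdeles_of_principal K k)]
    exact mul_mem (inv_mem (hinf ⟨_, rfl⟩))
      (Subgroup.mem_sup_right (principalIdeles_le_U K ⟨k, rfl⟩))
  refine eq_top_iff.2 fun x _ ↦ ?_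
  obtain ⟨p, rfl⟩ := (isHomeomorph_infToIdeles_mul_finToIdeles K).surjective x
  exact mul_mem (hinf ⟨_, rfl⟩) (hfin ⟨_, rfl⟩)

variable (K)

/-- The homomorphism `ô* → 𝔸*/U` through which `ô*` acts on the first factor of the balanced
product. -/
noncomputable def integralUnitsToQuotient : integralUnits K →* Ideles K ⧸ U K :=
  (QuotientGroup.mk' (U K)).comp ((finToIdeles K).comp (integralUnits K).subtype)

theorem continuous_integralUnitsToQuotient : Continuous (integralUnitsToQuotient K) :=
  QuotientGroup.continuous_mk.comp <|
    (Continuous.units_map _ (Continuous.prodMk_right (1 : K∞))).comp continuous_subtype_val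

theorem isOpenMap_integralUnitsToQuotient : IsOpenMap (integralUnitsToQuotient K) := by
  have hprod : IsOpenMap
      (Prod.map (↑) (↑) : Subgroup.connectedComponentOfOne (K∞)ˣ × integralUnits K →
        (K∞)ˣ × (𝔸ᶠ[K])ˣ) :=
    (isOpen_connectedComponentOfOne_infiniteAdele K).isOpenMap_subtype_val.prodMap
      (isOpen_integralUnits K).isOpenMap_subtype_val
  have hidele := (isHomeomorph_infToIdeles_mul_finToIdeles K).isOpenMap.comp hprod
  have hopen := (QuotientGroup.isOpenMap_coe (N := U K)).comp hidele
  have hsnd : IsOpenMap (integralUnitsToQuotient K ∘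
      (Prod.snd : Subgroup.connectedComponentOfOne (K∞)ˣ × integralUnits K → _)) := by
    convert hopen using 1
    ext1 ⟨c, r⟩
    have hc : (infToIdeles K c : Ideles K ⧸ U K) = 1 :=
      (QuotientGroup.eq_one_iff _).2 (infPos_le_U K (Subgroup.mem_map_of_mem _ c.2))
    exact (one_mul _).symm.trans (congrArg (· * integralUnitsToQuotient K r) hc.symm)
  exact IsOpenMap.of_comp continuous_snd Prod.snd_surjective hsnd

theorem surjective_integralUnitsToQuotient
    (h : (integralUnits K).map (finToIdeles K) ⊔ U K = ⊤) :
    Function.Surjective (integralUnitsToQuotient K) := by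
  intro q
  obtain ⟨x, rfl⟩ := QuotientGroup.mk_surjective q
  obtain ⟨_, ⟨r, hr, rfl⟩, u, hu, rfl⟩ :=
    Subgroup.mem_sup.1 (h ▸ Subgroup.mem_top x)
  exact ⟨⟨r, hr⟩, QuotientGroup.eq.2 (by simpa using hu)⟩

end Ideles

end AdelicQuotient

open AdelicQuotient in
theorem mainTheorem7_general (K : Type*) [Field K] [NumberField K]
    (hclass : NumberField.classNumber K = 1)
    (hsign : (Units.map (algebraMap (𝓞 K) K∞ : 𝓞 K →* K∞)).range ⊔
      Subgroup.connectedComponentOfOne (K∞)ˣ = ⊤) :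
    IsHomeomorph (phiStar K) := by
  have hπ : IsOpenQuotientMap (integralUnitsToQuotient K) :=
    ⟨surjective_integralUnitsToQuotient K (map_integralUnits_sup_U hclass hsign),
      continuous_integralUnitsToQuotient K, isOpenMap_integralUnitsToQuotient K⟩
  refine isHomeomorph_quotientMap_one_prodMk hπ (fun y y' ↦ ?_) (fun p q ↦ ?_) _
  · constructor
    · rintro ⟨z, ⟨hz, hzU⟩, h⟩
      exact ⟨⟨z, hz⟩, (QuotientGroup.eq_one_iff _).2 hzU, h⟩
    · rintro ⟨z, hz, h⟩
      exact ⟨z, ⟨z.2, (QuotientGroup.eq_one_iff (N := U K) _).1 hz⟩, h⟩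
  · constructor
    · rintro ⟨r, hr, h⟩
      exact ⟨⟨r, hr⟩, h⟩
    · rintro ⟨r, h⟩
      exact ⟨r, r.2, h⟩

theorem mainTheorem7 (K : Type*) [Field K] [NumberField K]
    (hclass : NumberField.classNumber K = 1)
    (hreal : NumberField.InfinitePlace.nrRealPlaces K ≤ 1) :
    IsHomeomorph (AdelicQuotient.phiStar K) :=
  mainTheorem7_general K hclass (AdelicQuotient.range_units_sup_connectedComponentOfOne hreal)
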